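/- For a positive integer $n$ and a subset $S\subseteq\{0,1,\dots,n\}$ let \[ \lambda(S)=\lambda_n(S)=\bigl(2n+1-|S+S|,\;2n+1-|S-S|\bigr), \] where $S+S=\{a+b: a,b\in S\}$ and $S-S=\{a-b: a,b\in S\}$; this is the pair consisting of the number of missing sums and the number of missing differences of $S$. Let $\Lambda\subseteq\mathbb{Z}_{\ge 0}\times\mathbb{Z}_{\ge 0}$ contain at least one pair $(s,d)$ with $d$ even, and for each $n$ let $S_n$ be a uniformly random subset of $\{0,1,\dots,n\}$. Then $\mathbb{P}(\lambda_n(S_n)\in\Lambda)>0$ for all sufficiently large $n$, and, as $n\to\infty$, \[ \mathbb{E}\bigl[\,|S_n| \,\bigm|\, \lambda_n(S_n)\in\Lambda\bigr]=\frac{n+1}{2}+O(\log n) \] and \[ \operatorname{Var}\bigl(|S_n| \,\bigm|\, \lambda_n(S_n)\in\Lambda\bigr)=\frac{n+1}{4}+O\bigl((\log n)^2\bigr), \] where the implied constants may depend on $\Lambda$. -/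

import Mathlib

open MeasureTheory ProbabilityTheory Asymptotics Filter
open scoped Pointwise ProbabilityTheory

/-- The pair `(2n+1 - |S+S|, 2n+1 - |S-S|)` of the numbers of missing sums and of missing
differences of `S ⊆ {0, …, n}`. For such `S` the natural-number subtractions are exact,
see `card_add_le_and_card_sub_le`. -/
def missing (n : ℕ) (S : Finset ℤ) : ℕ × ℕ :=
  (2 * n + 1 - (S + S).card, 2 * n + 1 - (S - S).card)

theorem card_add_le_and_card_sub_le (n : ℕ) (S : Finset ℤ) (hS : S ⊆ Finset.Icc 0 (n : ℤ)) :
    (S + S).card ≤ 2 * n + 1 ∧ (S - S).card ≤ 2 * n + 1 := by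
  constructor
  · have h : S + S ⊆ Finset.Icc 0 (2 * n : ℤ) := by
      intro x hx
      obtain ⟨a, ha, b, hb, rfl⟩ := Finset.mem_add.1 hx
      have ha := Finset.mem_Icc.1 (hS ha)
      have hb := Finset.mem_Icc.1 (hS hb)
      exact Finset.mem_Icc.2 ⟨by lia, by lia⟩
    have := Finset.card_le_card h
    rw [Int.card_Icc] at this
    lia
  · have h : S - S ⊆ Finset.Icc (-n : ℤ) n := by
      intro x hx
      obtain ⟨a, ha, b, hb, rfl⟩ := Finset.mem_sub.1 hx
      have ha := Finset.mem_Icc.1 (hS ha)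
      have hb := Finset.mem_Icc.1 (hS hb)
      exact Finset.mem_Icc.2 ⟨by lia, by lia⟩
    have := Finset.card_le_card h
    rw [Int.card_Icc] at this
    lia

/-- The law of a uniformly random subset of `{0, 1, …, n}`. -/
noncomputable def randomSubset (n : ℕ) : Measure (Finset ℤ) :=
  uniformOn {S : Finset ℤ | S ⊆ Finset.Icc 0 (n : ℤ)}

/-- The event `λ(S) ∈ Λ`. -/
def missingEvent (Λ : Set (ℕ × ℕ)) (n : ℕ) : Set (Finset ℤ) := {S | missing n S ∈ Λ}

/-- The law of a uniformly random subset `S` of `{0, 1, …, n}` conditioned on `λ(S) ∈ Λ`. -/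
noncomputable def conditionedSubset (Λ : Set (ℕ × ℕ)) (n : ℕ) : Measure (Finset ℤ) :=
  cond (randomSubset n) (missingEvent Λ n)

/-! A random set almost surely represents every sum and difference away from the extremes: a value
at distance `j` from the end is missed with probability at most `(9/10)^j`, since about `j/2`
disjoint pairs must all be avoided (`card_avoiding_le`). A union bound gives
`card_not_fillsMiddle_le`. Hence missing values are decided by the two fringes of the set.

Conditioning is harmless because the event has probability at least some `c > 0`, independent of
`n`. Fringes `A` at the left and `n - B` at the right, with `A`, `B` cofinite, realise any `s`
missing sums and any even number of missing differences (`exists_cofinite_sets_missing`,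
`missing_eq_of_fringe`); imposing them on a set whose middle is full costs only a constant factor
(`exists_pos_le_card_missing`).

With fringes of length `L ≈ 20 log n`, the middle fails to fill with probability `O(n⁻²)`, and
otherwise the event depends only on `S \ M`, where `M = [L, n - L]` (`missing_union_Icc`). So `S ∩
M` is nearly uniform and independent of the event: it contributes the binomial mean and variance,
while the `2L` fringe points shift them by `O(log n)` and `O((log n)²)`.
`moments_of_almost_determined` makes this quantitative. -/

/-! ### Sets avoiding many disjoint pairs. -/

/-- The pairs `{i, f i}` are disjoint, so they behave independently, and each leaves 3 of its 4
traces. The induction removes one pair from both `I` and `U`. -/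
theorem card_avoiding_le {α : Type*} [DecidableEq α] (f : α → α) (I U : Finset α) (hI : I ⊆ U)
    (hf : ∀ i ∈ I, f i ∈ U) (hinj : Set.InjOn f I) (hdisj : ∀ i ∈ I, f i ∉ I) :
    4 ^ I.card * (U.powerset.filter fun T => ∀ i ∈ I, ¬(i ∈ T ∧ f i ∈ T)).card
      ≤ 3 ^ I.card * 2 ^ U.card := by
  induction I using Finset.induction_on generalizing U with
  | empty => simp
  | insert a I ha ih =>
    have hab : f a ≠ a := fun h => hdisj a (by simp) (by simp [h])
    set X : Finset α := {a, f a} with hX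
    have hXc : X.card = 2 := Finset.card_pair hab.symm
    have hXU : X ⊆ U := by
      intro x hx
      rcases Finset.mem_insert.1 hx with rfl | hx
      · exact hI (by simp)
      · rw [Finset.mem_singleton.1 hx]; exact hf a (by simp)
    have hIX : ∀ i ∈ I, i ∉ X := by
      intro i hi h
      rcases Finset.mem_insert.1 h with rfl | h
      · exact ha hi
      · exact hdisj a (by simp) (by rw [← Finset.mem_singleton.1 h]; simp [hi])
    have hfX : ∀ i ∈ I, f i ∉ X := by
      intro i hi h
      rcases Finset.mem_insert.1 h with h | h
      · exact hdisj i (by simp [hi]) (by simp [h])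
      · have := hinj (by simp [hi]) (by simp) (Finset.mem_singleton.1 h)
        exact ha (this ▸ hi)
    have hU : (U \ X).card + 2 = U.card := by
      rw [← hXc]; exact Finset.card_sdiff_add_card_eq_card hXU
    have key := ih (U \ X) (fun i hi => Finset.mem_sdiff.2 ⟨hI (by simp [hi]), hIX i hi⟩)
      (fun i hi => Finset.mem_sdiff.2 ⟨hf i (by simp [hi]), hfX i hi⟩)
      (hinj.mono (by simp)) (fun i hi h => hdisj i (by simp [hi]) (by simp [h]))
    have hle : (U.powerset.filter fun T => ∀ i ∈ insert a I, ¬(i ∈ T ∧ f i ∈ T)).card ≤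
        ((U \ X).powerset.filter fun T => ∀ i ∈ I, ¬(i ∈ T ∧ f i ∈ T)).card * 3 := by
      have h3 : (X.powerset.erase X).card = 3 := by
        rw [Finset.card_erase_of_mem (by simp), Finset.card_powerset, hXc]; rfl
      rw [← h3, ← Finset.card_product]
      refine Finset.card_le_card_of_injOn (fun T => (T \ X, T ∩ X)) ?_ ?_
      · intro T hT
        simp only [Finset.coe_filter, Set.mem_ofPred_eq, Finset.mem_powerset] at hT
        obtain ⟨hTU, hT⟩ := hT
        simp only [Finset.coe_product, Set.mem_prod, Finset.mem_coe, Finset.mem_filter,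
          Finset.mem_powerset, Finset.mem_erase]
        refine ⟨⟨Finset.sdiff_subset_sdiff hTU le_rfl, fun i hi h => ?_⟩, fun h => ?_,
          Finset.inter_subset_right⟩
        · exact hT i (by simp [hi]) ⟨(Finset.mem_sdiff.1 h.1).1, (Finset.mem_sdiff.1 h.2).1⟩
        · have hXT : X ⊆ T := Finset.inter_eq_right.1 h
          exact hT a (by simp) ⟨hXT (by simp [hX]), hXT (by simp [hX])⟩
      · intro T _ T' _ h
        simp only [Prod.mk.injEq] at h
        rw [← Finset.sdiff_union_inter T X, h.1, h.2, Finset.sdiff_union_inter]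
    rw [Finset.card_insert_of_notMem ha, ← hU]
    calc _ ≤ 4 ^ (I.card + 1) * (((U \ X).powerset.filter
          fun T => ∀ i ∈ I, ¬(i ∈ T ∧ f i ∈ T)).card * 3) := Nat.mul_le_mul_left _ hle
      _ = 12 * (4 ^ I.card * ((U \ X).powerset.filter
          fun T => ∀ i ∈ I, ¬(i ∈ T ∧ f i ∈ T)).card) := by ring
      _ ≤ 12 * (3 ^ I.card * 2 ^ (U \ X).card) := Nat.mul_le_mul_left _ key
      _ = _ := by ring

theorem card_avoiding_le_pow {α : Type*} [DecidableEq α] (f : α → α) (I U : Finset α) (hI : I ⊆ U)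
    (hf : ∀ i ∈ I, f i ∈ U) (hinj : Set.InjOn f I) (hdisj : ∀ i ∈ I, f i ∉ I) (j : ℕ)
    (hj : j ≤ 2 * I.card) :
    ((U.powerset.filter fun T => ∀ i ∈ I, ¬(i ∈ T ∧ f i ∈ T)).card : ℝ)
      ≤ (9 / 10) ^ j * 2 ^ U.card := by
  have h := card_avoiding_le f I U hI hf hinj hdisj
  set N := (U.powerset.filter fun T => ∀ i ∈ I, ¬(i ∈ T ∧ f i ∈ T)).card
  have h' : (4 : ℝ) ^ I.card * N ≤ 3 ^ I.card * 2 ^ U.card := by exact_mod_cast h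
  have h1 : (N : ℝ) ≤ (3 / 4) ^ I.card * 2 ^ U.card := by
    rw [div_pow, div_mul_eq_mul_div, le_div_iff₀ (by positivity), mul_comm]; exact h'
  refine h1.trans (mul_le_mul_of_nonneg_right ?_ (by positivity))
  -- The base `9/10` is a convenient bound for `√(3/4)`; it lets the exponent be a distance instead
  -- of half of one.
  calc (3 / 4 : ℝ) ^ I.card ≤ ((9 / 10) ^ 2) ^ I.card :=
        pow_le_pow_left₀ (by norm_num) (by norm_num) _
    _ = (9 / 10) ^ (2 * I.card) := by rw [pow_mul]
    _ ≤ _ := pow_le_pow_of_le_one (by norm_num) (by norm_num) hj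

theorem card_sum_missing_le (a b k : ℤ) (U : Finset ℤ) (hU : Finset.Icc a b ⊆ U) (j : ℕ)
    (h1 : (j : ℤ) ≤ k - 2 * a) (h2 : (j : ℤ) ≤ 2 * b - k) :
    ((U.powerset.filter fun T => k ∉ (T ∩ Finset.Icc a b) + (T ∩ Finset.Icc a b)).card : ℝ)
      ≤ (9 / 10) ^ j * 2 ^ U.card := by
  -- These are the smaller members of the pairs `{x, k - x}` inside `[a, b]`; the upper limit
  -- excludes `x = k / 2`, which would be paired with itself.
  set I := Finset.Icc (max a (k - b)) ((k - 1) / 2) with hIdef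
  have hI : ∀ x ∈ I, x ∈ Finset.Icc a b ∧ k - x ∈ Finset.Icc a b := by
    intro x hx
    simp only [hIdef, Finset.mem_Icc, max_le_iff] at hx ⊢
    omega
  refine le_trans ?_ (card_avoiding_le_pow (fun x => k - x) I U (fun x hx => hU (hI x hx).1)
    (fun x hx => hU (hI x hx).2) (fun x _ y _ h => by simpa using h) ?_ j ?_)
  · norm_cast
    refine Finset.card_le_card (Finset.monotone_filter_right _ fun T _ hT i hi hh => hT ?_)
    exact Finset.mem_add.2 ⟨i, Finset.mem_inter.2 ⟨hh.1, (hI i hi).1⟩, k - i,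
      Finset.mem_inter.2 ⟨hh.2, (hI i hi).2⟩, by ring⟩
  · intro x hx hx'
    simp only [hIdef, Finset.mem_Icc, max_le_iff] at hx hx'
    omega
  · rw [hIdef, Int.card_Icc]
    rcases le_total a (k - b) with h | h
    · rw [max_eq_right h]; omega
    · rw [max_eq_left h]; omega

theorem card_sub_missing_le (a b k : ℤ) (hk : 1 ≤ k) (U : Finset ℤ) (hU : Finset.Icc a b ⊆ U)
    (j : ℕ) (h1 : (j : ℤ) ≤ b - a - k) :
    ((U.powerset.filter fun T => k ∉ (T ∩ Finset.Icc a b) - (T ∩ Finset.Icc a b)).card : ℝ)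
      ≤ (9 / 10) ^ j * 2 ^ U.card := by
  -- The pairs `{x, x + k}` overlap in chains. Cutting `[a, b]` into blocks of length `k` and
  -- starting pairs only in even blocks makes them disjoint.
  set I := (Finset.Icc a (b - k)).filter (fun x => (x - a) / k % 2 = 0) with hIdef
  have hI : ∀ x ∈ I, x ∈ Finset.Icc a b ∧ x + k ∈ Finset.Icc a b := by
    intro x hx
    simp only [hIdef, Finset.mem_filter, Finset.mem_Icc] at hx ⊢
    omega
  have hdiv : ∀ x, (x + k - a) / k = (x - a) / k + 1 := by
    intro x
    rw [show x + k - a = (x - a) + k by ring, Int.add_ediv_of_dvd_right dvd_rfl,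
      Int.ediv_self (by omega)]
  refine le_trans ?_ (card_avoiding_le_pow (fun x => x + k) I U (fun x hx => hU (hI x hx).1)
    (fun x hx => hU (hI x hx).2) (fun x _ y _ h => by simpa using h) ?_ j ?_)
  · norm_cast
    refine Finset.card_le_card (Finset.monotone_filter_right _ fun T _ hT i hi hh => hT ?_)
    exact Finset.mem_sub.2 ⟨i + k, Finset.mem_inter.2 ⟨hh.2, (hI i hi).2⟩, i,
      Finset.mem_inter.2 ⟨hh.1, (hI i hi).1⟩, by ring⟩
  · intro x hx hx'
    simp only [hIdef, Finset.mem_filter, hdiv] at hx hx'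
    omega
  -- Translation by `-k` injects odd blocks into even ones, so at least half of the starting points
  -- are kept.
  · have hc : ((Finset.Icc a (b - k)).filter (fun x => ¬ (x - a) / k % 2 = 0)).card ≤ I.card := by
      refine Finset.card_le_card_of_injOn (fun x => x - k) ?_ (fun x _ y _ h => by simpa using h)
      intro x hx
      simp only [Finset.coe_filter, Set.mem_ofPred_eq, Finset.mem_Icc] at hx
      have hd := hdiv (x - k)
      rw [sub_add_cancel] at hd
      have hxk : k ≤ x - a := by
        by_contra hlt
        rw [Int.ediv_eq_zero_of_lt (by omega) (by omega)] at hx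
        omega
      simp only [hIdef, Finset.coe_filter, Set.mem_ofPred_eq, Finset.mem_Icc]
      refine ⟨⟨by omega, by omega⟩, by omega⟩
    have hs := Finset.card_filter_add_card_filter_not (s := Finset.Icc a (b - k))
      (fun x => (x - a) / k % 2 = 0)
    rw [Int.card_Icc] at hs
    have : I.card = ((Finset.Icc a (b - k)).filter (fun x => (x - a) / k % 2 = 0)).card := rfl
    omega

/-! ### Most sets have a full middle. -/

/-- The part of `T` in `[a, b]` has all sums and differences at distance at least `L` from the
extreme ones. -/
def FillsMiddle (a b : ℤ) (L : ℕ) (T : Finset ℤ) : Prop :=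
  Finset.Icc (2 * a + L) (2 * b - L) ⊆ (T ∩ Finset.Icc a b) + (T ∩ Finset.Icc a b) ∧
  Finset.Icc (-(b - a - L)) (b - a - L) ⊆ (T ∩ Finset.Icc a b) - (T ∩ Finset.Icc a b)

theorem FillsMiddle.mono {a b : ℤ} {L : ℕ} {T T' : Finset ℤ} (h : FillsMiddle a b L T)
    (hT : T ∩ Finset.Icc a b ⊆ T') : FillsMiddle a b L T' := by
  have hT' : T ∩ Finset.Icc a b ⊆ T' ∩ Finset.Icc a b :=
    Finset.subset_inter hT Finset.inter_subset_right
  exact ⟨h.1.trans (Finset.add_subset_add hT' hT'), h.2.trans (Finset.sub_subset_sub hT' hT')⟩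

theorem sum_pow_le_of_injOn (J : Finset ℤ) (g : ℤ → ℕ) (L : ℕ) (hg : Set.InjOn g J)
    (hL : ∀ k ∈ J, L ≤ g k) : ∑ k ∈ J, (9 / 10 : ℝ) ^ g k ≤ 10 * (9 / 10) ^ L := by
  have hg' : Set.InjOn (fun k => g k - L) J := by
    intro x hx y hy h
    have h1 := hL x hx
    have h2 := hL y hy
    refine hg hx hy ?_
    simp only at h
    omega
  have : ∑ k ∈ J, (9 / 10 : ℝ) ^ g k = (9 / 10) ^ L * ∑ i ∈ J.image (fun k => g k - L),
      (9 / 10 : ℝ) ^ i := by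
    rw [Finset.sum_image hg', Finset.mul_sum]
    refine Finset.sum_congr rfl fun k hk => ?_
    rw [← pow_add, Nat.add_sub_cancel' (hL k hk)]
  rw [this, mul_comm]
  refine mul_le_mul_of_nonneg_right ?_ (by positivity)
  have h := (summable_geometric_of_lt_one (r := (9 / 10 : ℝ)) (by norm_num)
    (by norm_num)).sum_le_tsum (J.image (fun k => g k - L)) (fun i _ => by positivity)
  rw [tsum_geometric_of_lt_one (by norm_num) (by norm_num)] at h
  norm_num at h ⊢
  exact h

open Classical in
-- A union bound over the missed values. Each end of a range contributes a geometric tail `10 *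
-- (9/10)^L`: two ends for sums, and one for differences, where by symmetry positive ones suffice.
theorem card_not_fillsMiddle_le (a b : ℤ) (L : ℕ) (hab : L < b - a) (U : Finset ℤ)
    (hU : Finset.Icc a b ⊆ U) :
    ((U.powerset.filter fun T => ¬ FillsMiddle a b L T).card : ℝ)
      ≤ 30 * (9 / 10) ^ L * 2 ^ U.card := by
  set J₁ := Finset.Icc (2 * a + L) (2 * b - L) with hJ₁
  set J₂ := Finset.Icc 1 (b - a - L) with hJ₂
  set B₁ : ℤ → Finset (Finset ℤ) := fun k =>
    U.powerset.filter fun T => k ∉ (T ∩ Finset.Icc a b) + (T ∩ Finset.Icc a b)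
  set B₂ : ℤ → Finset (Finset ℤ) := fun k =>
    U.powerset.filter fun T => k ∉ (T ∩ Finset.Icc a b) - (T ∩ Finset.Icc a b)
  have hsub : (U.powerset.filter fun T => ¬ FillsMiddle a b L T) ⊆
      J₁.biUnion B₁ ∪ J₂.biUnion B₂ := by
    intro T hT
    obtain ⟨hTU, hT⟩ := Finset.mem_filter.1 hT
    by_contra hcon
    simp only [Finset.mem_union, Finset.mem_biUnion, not_or, not_exists, not_and, B₁, B₂,
      Finset.mem_filter, hTU, true_and, not_not] at hcon
    refine hT ⟨fun k hk => hcon.1 k hk, fun k hk => ?_⟩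
    rw [Finset.mem_Icc] at hk
    rcases lt_trichotomy k 0 with hk0 | rfl | hk0
    · obtain ⟨x, hx, y, hy, hxy⟩ := Finset.mem_sub.1 (hcon.2 (-k)
        (Finset.mem_Icc.2 ⟨by omega, by omega⟩))
      exact Finset.mem_sub.2 ⟨y, hy, x, hx, by omega⟩
    -- Difference 0 only needs a nonempty set, which follows because difference 1 occurs; `hab` puts
    -- 1 in `J₂`.
    · obtain ⟨x, hx, y, hy, hxy⟩ := Finset.mem_sub.1 (hcon.2 1
        (Finset.mem_Icc.2 ⟨by omega, by omega⟩))
      exact Finset.mem_sub.2 ⟨x, hx, x, hx, by omega⟩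
    · exact hcon.2 k (Finset.mem_Icc.2 ⟨by omega, by omega⟩)
  have h1 : ∑ k ∈ J₁, ((B₁ k).card : ℝ) ≤ 20 * (9 / 10) ^ L * 2 ^ U.card := by
    have hk : ∀ k ∈ J₁, ((B₁ k).card : ℝ) ≤
        ((9 / 10) ^ (k - 2 * a).toNat + (9 / 10) ^ (2 * b - k).toNat) * 2 ^ U.card := by
      intro k hk
      rw [hJ₁, Finset.mem_Icc] at hk
      rcases le_total (k - 2 * a) (2 * b - k) with h | h
      · refine (card_sum_missing_le a b k U hU (k - 2 * a).toNat (by omega) (by omega)).trans ?_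
        exact mul_le_mul_of_nonneg_right (le_add_of_nonneg_right (by positivity)) (by positivity)
      · refine (card_sum_missing_le a b k U hU (2 * b - k).toNat (by omega) (by omega)).trans ?_
        exact mul_le_mul_of_nonneg_right (le_add_of_nonneg_left (by positivity)) (by positivity)
    refine (Finset.sum_le_sum hk).trans ?_
    rw [← Finset.sum_mul, Finset.sum_add_distrib]
    refine mul_le_mul_of_nonneg_right ?_ (by positivity)
    have e1 := sum_pow_le_of_injOn J₁ (fun k => (k - 2 * a).toNat) L
      (fun x hx y hy h => by
        simp only [hJ₁, Finset.coe_Icc, Set.mem_Icc] at hx hy h; omega)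
      (fun k hk => by rw [hJ₁, Finset.mem_Icc] at hk; omega)
    have e2 := sum_pow_le_of_injOn J₁ (fun k => (2 * b - k).toNat) L
      (fun x hx y hy h => by
        simp only [hJ₁, Finset.coe_Icc, Set.mem_Icc] at hx hy h; omega)
      (fun k hk => by rw [hJ₁, Finset.mem_Icc] at hk; omega)
    linarith
  have h2 : ∑ k ∈ J₂, ((B₂ k).card : ℝ) ≤ 10 * (9 / 10) ^ L * 2 ^ U.card := by
    have hk : ∀ k ∈ J₂, ((B₂ k).card : ℝ) ≤ (9 / 10) ^ (b - a - k).toNat * 2 ^ U.card := by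
      intro k hk
      rw [hJ₂, Finset.mem_Icc] at hk
      exact card_sub_missing_le a b k hk.1 U hU _ (by omega)
    refine (Finset.sum_le_sum hk).trans ?_
    rw [← Finset.sum_mul]
    refine mul_le_mul_of_nonneg_right ?_ (by positivity)
    exact sum_pow_le_of_injOn J₂ (fun k => (b - a - k).toNat) L
      (fun x hx y hy h => by
        simp only [hJ₂, Finset.coe_Icc, Set.mem_Icc] at hx hy h; omega)
      (fun k hk => by rw [hJ₂, Finset.mem_Icc] at hk; omega)
  have h3 : ((U.powerset.filter fun T => ¬ FillsMiddle a b L T).card : ℝ) ≤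
      ∑ k ∈ J₁, ((B₁ k).card : ℝ) + ∑ k ∈ J₂, ((B₂ k).card : ℝ) := by
    norm_cast
    exact (Finset.card_le_card hsub).trans ((Finset.card_union_le _ _).trans
      (add_le_add Finset.card_biUnion_le Finset.card_biUnion_le))
  linarith

/-! ### Prescribed fringes and positive probability. -/

/-- For all `s` and `e` there are cofinite sets `A`, `B` of natural numbers such that `A + A` and
`B + B` miss `s` numbers altogether and `A + B` misses `e` numbers. -/
theorem exists_cofinite_sets_missing (s e : ℕ) :
    ∃ (A B : Set ℕ) (P Q R : Finset ℕ) (K : ℕ), (∀ k, K ≤ k → k ∈ A ∧ k ∈ B) ∧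
      (∀ k, k ∈ P ↔ ∀ a ∈ A, ∀ b ∈ A, a + b ≠ k) ∧ (∀ k, k ∈ Q ↔ ∀ a ∈ B, ∀ b ∈ B, a + b ≠ k) ∧
      (∀ k, k ∈ R ↔ ∀ a ∈ A, ∀ b ∈ B, a + b ≠ k) ∧ P.card + Q.card = s ∧ R.card = e := by
  rcases le_or_gt (2 * e) s with h | h
  · obtain ⟨k, rfl⟩ := Nat.exists_eq_add_of_le h
    -- Here `s = 2e + k`. The minimum `e` of `A` costs `2e` sums in `A + A` and `e` in `A + B`; the
    -- gap of length `k` after it costs `k` more sums in `A + A` and is repaired in `A + B` by `B =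
    -- ℕ`.
    refine ⟨{a | a = e ∨ e + k + 1 ≤ a}, Set.univ,
      Finset.range (2 * e) ∪ Finset.Icc (2 * e + 1) (2 * e + k), ∅, Finset.range e, e + k + 1,
      fun i hi => ⟨Or.inr hi, trivial⟩, fun i => ?_, fun i => ?_, fun i => ?_, ?_, by simp⟩
    · simp only [Finset.mem_union, Finset.mem_range, Finset.mem_Icc, Set.mem_ofPred_eq]
      constructor
      · intro hi a ha b hb
        omega
      · intro H
        by_contra hi
        rcases eq_or_ne i (2 * e) with rfl | hne
        · exact H e (Or.inl rfl) e (Or.inl rfl) (by omega)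
        · exact H e (Or.inl rfl) (i - e) (by omega) (by omega)
    · simp only [Finset.notMem_empty, false_iff]
      exact fun H => H 0 trivial i trivial (by omega)
    · simp only [Finset.mem_range, Set.mem_ofPred_eq]
      constructor
      · intro hi a ha b _
        omega
      · intro H
        by_contra hi
        exact H e (Or.inl rfl) (i - e) trivial (by omega)
    · rw [Finset.card_union_of_disjoint, Finset.card_range, Nat.card_Icc, Finset.card_empty]
      · omega
      · rw [Finset.disjoint_left]
        intro x hx hx'
        rw [Finset.mem_range] at hx
        rw [Finset.mem_Icc] at hx'
        omega
  · obtain ⟨t, c, hc, rfl⟩ : ∃ t c, c < 2 ∧ s = 2 * t + c := ⟨s / 2, s % 2, by omega, by omega⟩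
    obtain ⟨j, hj, rfl⟩ : ∃ j, 1 ≤ j ∧ e = t + j := ⟨e - t, by omega, by omega⟩
    -- Modulo 9, `{0,1,2,5,8}` and `{0,1,3,4}` each have every residue as a sum with themselves, but
    -- their mixed sums omit exactly 7. Keeping the pattern up to `7 + 9j` thus loses `j` mixed sums
    -- and no others. Shifting `A` by `t` loses `2t` sums in `A + A` and `t` mixed ones. If `c = 1`,
    -- deleting 8 from the unshifted `A` loses exactly the sum 8, whose only representation is `0 +
    -- 8`.
    refine ⟨{a | t ≤ a ∧ (7 + 9 * j ≤ a - t ∨ ((a - t) % 9 = 0 ∨ (a - t) % 9 = 1 ∨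
        (a - t) % 9 = 2 ∨ (a - t) % 9 = 5 ∨ (a - t) % 9 = 8) ∧ ¬ (c = 1 ∧ a - t = 8))},
      {b | 7 + 9 * j ≤ b ∨ b % 9 = 0 ∨ b % 9 = 1 ∨ b % 9 = 3 ∨ b % 9 = 4},
      Finset.range (2 * t) ∪ (Finset.range c).image (fun _ => 2 * t + 8), ∅,
      Finset.range t ∪ (Finset.range j).image (fun i => t + (7 + 9 * i)),
      t + (7 + 9 * j), fun i hi => ⟨⟨by omega, by omega⟩, Or.inl (by omega)⟩,
      fun i => ?_, fun i => ?_, fun i => ?_, ?_, ?_⟩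
    · simp only [Finset.mem_union, Finset.mem_range, Finset.mem_image, Set.mem_ofPred_eq]
      constructor
      · rintro (hi | ⟨y, hy, rfl⟩) a ha b hb
        · omega
        · intro hab
          obtain ⟨a, rfl⟩ := Nat.exists_eq_add_of_le ha.1
          obtain ⟨b, rfl⟩ := Nat.exists_eq_add_of_le hb.1
          have h8 : a + b = 8 := by omega
          obtain rfl : c = 1 := by omega
          have ha' := ha.2
          have hb' := hb.2
          rw [Nat.add_sub_cancel_left] at ha' hb'
          have : a ≤ 8 := by omega
          interval_cases a <;> omega
      · intro H
        by_contra! hi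
        obtain ⟨hi, hi'⟩ := hi
        obtain ⟨i, rfl⟩ := Nat.exists_eq_add_of_le hi
        have H' : ∀ a b, a + b = i → (7 + 9 * j ≤ a ∨ (a % 9 = 0 ∨ a % 9 = 1 ∨
            a % 9 = 2 ∨ a % 9 = 5 ∨ a % 9 = 8) ∧ ¬ (c = 1 ∧ a = 8)) →
            ¬ (b % 9 = 0 ∨ b % 9 = 1 ∨ b % 9 = 2) := by
          intro a b hab ha hb
          refine H (t + a) ⟨by omega, ?_⟩ (t + b) ⟨by omega, ?_⟩ (by omega)
          · rw [Nat.add_sub_cancel_left]; exact ha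
          · rw [Nat.add_sub_cancel_left]; right; omega
        have hi8 : ¬ (c = 1 ∧ i = 8) := fun hh => hi' 0 (by omega) (by omega)
        have h0 := H' i 0
        have h1 := H' (i - 1) 1
        have h2 := H' (i - 2) 2
        have : i % 9 < 9 := Nat.mod_lt _ (by norm_num)
        rcases (by omega : (i % 9 = 0 ∨ i % 9 = 1 ∨ i % 9 = 2 ∨ i % 9 = 5 ∨ i % 9 = 8) ∨
          (i % 9 = 3 ∨ i % 9 = 6) ∨ (i % 9 = 4 ∨ i % 9 = 7)) with hr | hr | hr
        · exact h0 rfl (Or.inr ⟨hr, hi8⟩) (by omega)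
        · exact h1 (by omega) (Or.inr ⟨by omega, by omega⟩) (by omega)
        · exact h2 (by omega) (Or.inr ⟨by omega, by omega⟩) (by omega)
    · simp only [Finset.notMem_empty, false_iff, Set.mem_ofPred_eq]
      intro H
      have H' : ∀ a b, a + b = i → (a % 9 = 0 ∨ a % 9 = 1 ∨ a % 9 = 3 ∨ a % 9 = 4) →
          ¬ (b % 9 = 0 ∨ b % 9 = 1 ∨ b % 9 = 3 ∨ b % 9 = 4) :=
        fun a b hab ha hb => H a (Or.inr ha) b (Or.inr hb) hab
      have h0 := H' i 0
      have h1 := H' (i - 1) 1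
      have h3 := H' (i - 3) 3
      have h4 := H' (i - 4) 4
      omega
    · simp only [Finset.mem_union, Finset.mem_range, Finset.mem_image, Set.mem_ofPred_eq]
      constructor
      · rintro (hi | ⟨y, hy, rfl⟩) a ha b hb
        · omega
        · intro hab
          obtain ⟨a, rfl⟩ := Nat.exists_eq_add_of_le ha.1
          have h8 : a + b = 7 + 9 * y := by omega
          have ha' := ha.2
          rw [Nat.add_sub_cancel_left] at ha'
          have ha2 : a % 9 = 0 ∨ a % 9 = 1 ∨ a % 9 = 2 ∨ a % 9 = 5 ∨ a % 9 = 8 := by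
            rcases ha' with h | h
            · omega
            · exact h.1
          have hb2 : b % 9 = 0 ∨ b % 9 = 1 ∨ b % 9 = 3 ∨ b % 9 = 4 := by
            rcases hb with h | h
            · omega
            · exact h
          omega
      · intro H
        by_contra! hi
        obtain ⟨hi, hi'⟩ := hi
        obtain ⟨i, rfl⟩ := Nat.exists_eq_add_of_le hi
        have H' : ∀ a b, a + b = i → (7 + 9 * j ≤ a ∨ (a % 9 = 0 ∨ a % 9 = 1 ∨
            a % 9 = 2 ∨ a % 9 = 5 ∨ a % 9 = 8) ∧ ¬ (c = 1 ∧ a = 8)) →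
            ¬ (b % 9 = 0 ∨ b % 9 = 1 ∨ b % 9 = 3 ∨ b % 9 = 4) := by
          intro a b hab ha hb
          refine H (t + a) ⟨by omega, ?_⟩ b (Or.inr hb) (by omega)
          rw [Nat.add_sub_cancel_left]; exact ha
        have h0 := H' i 0
        have h1 := H' (i - 1) 1
        have h3 := H' (i - 3) 3
        have h4 := H' (i - 4) 4
        have : i % 9 < 9 := Nat.mod_lt _ (by norm_num)
        rcases (by omega : (i % 9 = 0 ∨ i % 9 = 1 ∨ i % 9 = 2 ∨ i % 9 = 5) ∨
          (i % 9 = 3 ∨ i % 9 = 8) ∨ i % 9 = 4 ∨ i % 9 = 6 ∨ i % 9 = 7) with hr | hr | hr | hr | hr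
        · exact h0 rfl (Or.inr ⟨by omega, by omega⟩) (by omega)
        · exact h3 (by omega) (Or.inr ⟨by omega, by omega⟩) (by omega)
        · exact h4 (by omega) (Or.inr ⟨by omega, by omega⟩) (by omega)
        · exact h1 (by omega) (Or.inr ⟨by omega, by omega⟩) (by omega)
        · refine h0 rfl (Or.inl ?_) (by omega)
          by_contra hlt
          exact hi' ((i - 7) / 9) (by omega) (by omega)
    · rw [Finset.card_union_of_disjoint, Finset.card_range, Finset.card_empty, add_zero,
        Finset.card_image_of_injOn, Finset.card_range]
      · intro x hx y hy _
        simp only [Finset.coe_range, Set.mem_Iio] at hx hy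
        omega
      · rw [Finset.disjoint_left]
        intro x hx hx'
        rw [Finset.mem_range] at hx
        obtain ⟨y, _, rfl⟩ := Finset.mem_image.1 hx'
        omega
    · rw [Finset.card_union_of_disjoint, Finset.card_range,
        Finset.card_image_of_injective, Finset.card_range]
      · intro x y h
        simp only at h
        omega
      · rw [Finset.disjoint_left]
        intro x hx hx'
        rw [Finset.mem_range] at hx
        obtain ⟨y, _, rfl⟩ := Finset.mem_image.1 hx'
        omega

/-- Sums near 0 see only `A`, sums near `2n` only `B`, and differences near `n` pair the two, so the
losses there are `P`, `Q`, `R`. Nothing is lost in between since `S` fills its middle. Differences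
are symmetric under negation, so `R` counts twice. -/
theorem missing_eq_of_fringe {A B : Set ℕ} {P Q R : Finset ℕ} {K : ℕ}
    (hK : ∀ k, K ≤ k → k ∈ A ∧ k ∈ B)
    (hP : ∀ k, k ∈ P ↔ ∀ a ∈ A, ∀ b ∈ A, a + b ≠ k)
    (hQ : ∀ k, k ∈ Q ↔ ∀ a ∈ B, ∀ b ∈ B, a + b ≠ k)
    (hR : ∀ k, k ∈ R ↔ ∀ a ∈ A, ∀ b ∈ B, a + b ≠ k)
    {n L' : ℕ} (hn : 2 * (2 * K + L') < n) {S : Finset ℤ} (hS : S ⊆ Finset.Icc 0 (n : ℤ))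
    (hSA : ∀ x : ℕ, x < 2 * K + L' → ((x : ℤ) ∈ S ↔ x ∈ A))
    (hSB : ∀ x : ℕ, x < 2 * K + L' → ((n : ℤ) - x ∈ S ↔ x ∈ B))
    (hfill : FillsMiddle K (n - K) L' S) :
    missing n S = (P.card + Q.card, R.card + R.card) := by
  have hPK : ∀ k ∈ P, k < 2 * K := by
    intro k hk
    by_contra hlt
    exact (hP k).1 hk K (hK K le_rfl).1 (k - K) (hK _ (by omega)).1 (by omega)
  have hQK : ∀ k ∈ Q, k < 2 * K := by
    intro k hk
    by_contra hlt
    exact (hQ k).1 hk K (hK K le_rfl).2 (k - K) (hK _ (by omega)).2 (by omega)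
  have hRK : ∀ k ∈ R, k < 2 * K := by
    intro k hk
    by_contra hlt
    exact (hR k).1 hk K (hK K le_rfl).1 (k - K) (hK _ (by omega)).2 (by omega)
  have hS0 : ∀ x ∈ S, ∃ a : ℕ, x = a ∧ a ≤ n := by
    intro x hx
    have := Finset.mem_Icc.1 (hS hx)
    exact ⟨x.toNat, by omega, by omega⟩
  have hSn : ∀ x ∈ S, ∃ a : ℕ, x = n - a ∧ a ≤ n := by
    intro x hx
    have := Finset.mem_Icc.1 (hS hx)
    exact ⟨(n - x).toNat, by omega, by omega⟩
  have hP' : ∀ k : ℕ, k < 2 * K + L' → ((k : ℤ) ∉ S + S ↔ k ∈ P) := by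
    intro k hk
    rw [hP]
    constructor
    · intro h a ha b hb hab
      exact h (Finset.mem_add.2 ⟨a, (hSA a (by omega)).2 ha, b, (hSA b (by omega)).2 hb,
        by exact_mod_cast hab⟩)
    · intro h hk'
      obtain ⟨x, hx, y, hy, hxy⟩ := Finset.mem_add.1 hk'
      obtain ⟨a, rfl, ha⟩ := hS0 x hx
      obtain ⟨b, rfl, hb⟩ := hS0 y hy
      have hab : a + b = k := by exact_mod_cast hxy
      exact h a ((hSA a (by omega)).1 hx) b ((hSA b (by omega)).1 hy) hab
  have hQ' : ∀ k : ℕ, k < 2 * K + L' → (2 * (n : ℤ) - k ∉ S + S ↔ k ∈ Q) := by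
    intro k hk
    rw [hQ]
    constructor
    · intro h a ha b hb hab
      exact h (Finset.mem_add.2 ⟨n - a, (hSB a (by omega)).2 ha, n - b, (hSB b (by omega)).2 hb,
        by omega⟩)
    · intro h hk'
      obtain ⟨x, hx, y, hy, hxy⟩ := Finset.mem_add.1 hk'
      obtain ⟨a, rfl, ha⟩ := hSn x hx
      obtain ⟨b, rfl, hb⟩ := hSn y hy
      exact h a ((hSB a (by omega)).1 hx) b ((hSB b (by omega)).1 hy) (by omega)
  have hR' : ∀ k : ℕ, k < 2 * K + L' → ((n : ℤ) - k ∉ S - S ↔ k ∈ R) := by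
    intro k hk
    rw [hR]
    constructor
    · intro h a ha b hb hab
      exact h (Finset.mem_sub.2 ⟨n - b, (hSB b (by omega)).2 hb, a, (hSA a (by omega)).2 ha,
        by omega⟩)
    · intro h hk'
      obtain ⟨x, hx, y, hy, hxy⟩ := Finset.mem_sub.1 hk'
      obtain ⟨a, rfl, ha⟩ := hSn x hx
      obtain ⟨b, rfl, hb⟩ := hS0 y hy
      exact h b ((hSA b (by omega)).1 hy) a ((hSB a (by omega)).1 hx) (by omega)
  have hneg : ∀ k : ℤ, -k ∈ S - S ↔ k ∈ S - S := by
    intro k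
    constructor <;>
    · intro h
      obtain ⟨x, hx, y, hy, hxy⟩ := Finset.mem_sub.1 h
      exact Finset.mem_sub.2 ⟨y, hy, x, hx, by omega⟩
  have hmid : ∀ k : ℤ, 2 * K + L' ≤ k → k ≤ 2 * n - (2 * K + L') → k ∈ S + S := fun k h1 h2 =>
    Finset.add_subset_add Finset.inter_subset_left Finset.inter_subset_left
      (hfill.1 (Finset.mem_Icc.2 ⟨by omega, by omega⟩))
  have hmid' : ∀ k : ℤ, -(n - (2 * K + L')) ≤ k → k ≤ n - (2 * K + L') → k ∈ S - S :=
    fun k h1 h2 => Finset.sub_subset_sub Finset.inter_subset_left Finset.inter_subset_left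
      (hfill.2 (Finset.mem_Icc.2 ⟨by omega, by omega⟩))
  have hadd : Finset.Icc 0 (2 * n : ℤ) \ (S + S) =
      P.image (fun k : ℕ => (k : ℤ)) ∪ Q.image (fun k : ℕ => 2 * (n : ℤ) - k) := by
    ext k
    simp only [Finset.mem_sdiff, Finset.mem_Icc, Finset.mem_union, Finset.mem_image]
    constructor
    · rintro ⟨hk, hkS⟩
      rcases lt_or_ge k (2 * K + L') with h | h
      · refine Or.inl ⟨k.toNat, (hP' _ (by omega)).1 ?_, by omega⟩
        rwa [Int.toNat_of_nonneg hk.1]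
      · rcases le_or_gt k (2 * n - (2 * K + L')) with h' | h'
        · exact absurd (hmid k h h') hkS
        · refine Or.inr ⟨(2 * n - k).toNat, (hQ' _ (by omega)).1 ?_, by omega⟩
          rwa [Int.toNat_of_nonneg (by omega), sub_sub_cancel]
    · rintro (⟨i, hi, rfl⟩ | ⟨i, hi, rfl⟩)
      · have := hPK i hi
        exact ⟨by omega, (hP' i (by omega)).2 hi⟩
      · have := hQK i hi
        exact ⟨by omega, (hQ' i (by omega)).2 hi⟩
  have hsub : Finset.Icc (-n : ℤ) n \ (S - S) =
      R.image (fun k : ℕ => (n : ℤ) - k) ∪ R.image (fun k : ℕ => -((n : ℤ) - k)) := by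
    ext k
    simp only [Finset.mem_sdiff, Finset.mem_Icc, Finset.mem_union, Finset.mem_image]
    constructor
    · rintro ⟨hk, hkS⟩
      rcases lt_or_ge (n - (2 * K + L') : ℤ) k with h | h
      · refine Or.inl ⟨(n - k).toNat, (hR' _ (by omega)).1 ?_, by omega⟩
        rwa [Int.toNat_of_nonneg (by omega), sub_sub_cancel]
      · rcases le_or_gt (-(n - (2 * K + L') : ℤ)) k with h' | h'
        · exact absurd (hmid' k h' h) hkS
        · refine Or.inr ⟨(n + k).toNat, (hR' _ (by omega)).1 ?_, by omega⟩
          rw [← hneg, Int.toNat_of_nonneg (by omega)]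
          rwa [show -((n : ℤ) - (n + k)) = k by ring]
    · rintro (⟨i, hi, rfl⟩ | ⟨i, hi, rfl⟩)
      · have := hRK i hi
        exact ⟨by omega, (hR' i (by omega)).2 hi⟩
      · have := hRK i hi
        refine ⟨by omega, ?_⟩
        rw [hneg]
        exact (hR' i (by omega)).2 hi
  have hSS : S + S ⊆ Finset.Icc 0 (2 * n : ℤ) := by
    intro x hx
    obtain ⟨a, ha, b, hb, rfl⟩ := Finset.mem_add.1 hx
    have ha := Finset.mem_Icc.1 (hS ha)
    have hb := Finset.mem_Icc.1 (hS hb)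
    exact Finset.mem_Icc.2 ⟨by omega, by omega⟩
  have hSS' : S - S ⊆ Finset.Icc (-n : ℤ) n := by
    intro x hx
    obtain ⟨a, ha, b, hb, rfl⟩ := Finset.mem_sub.1 hx
    have ha := Finset.mem_Icc.1 (hS ha)
    have hb := Finset.mem_Icc.1 (hS hb)
    exact Finset.mem_Icc.2 ⟨by omega, by omega⟩
  have c1 := congrArg Finset.card hadd
  have c2 := congrArg Finset.card hsub
  rw [Finset.card_sdiff_of_subset hSS, Int.card_Icc, Finset.card_union_of_disjoint,
    Finset.card_image_of_injective _ (fun x y h => by simpa using h),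
    Finset.card_image_of_injective _ (fun x y h => by simpa using h)] at c1
  · rw [Finset.card_sdiff_of_subset hSS', Int.card_Icc, Finset.card_union_of_disjoint,
      Finset.card_image_of_injective _ (fun x y h => by simpa using h),
      Finset.card_image_of_injective _ (fun x y h => by simpa using h)] at c2
    · rw [missing, ← c1, ← c2]
      congr 2; omega
    · rw [Finset.disjoint_left]
      intro x hx hx'
      obtain ⟨i, hi, rfl⟩ := Finset.mem_image.1 hx
      obtain ⟨i', hi', h⟩ := Finset.mem_image.1 hx'
      have := hRK i hi
      have := hRK i' hi'
      omega
  · rw [Finset.disjoint_left]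
    intro x hx hx'
    obtain ⟨i, hi, rfl⟩ := Finset.mem_image.1 hx
    obtain ⟨i', hi', h⟩ := Finset.mem_image.1 hx'
    have := hPK i hi
    have := hQK i' hi'
    omega

open Classical in
/-- A positive proportion of the subsets of `{0, …, n}` has `s` missing sums and `2 * e` missing
differences. -/
theorem exists_pos_le_card_missing (s e : ℕ) : ∃ c : ℝ, 0 < c ∧ ∀ᶠ n : ℕ in atTop,
    c * 2 ^ (n + 1) ≤ (((Finset.Icc 0 (n : ℤ)).powerset.filter
      fun S => missing n S = (s, e + e)).card : ℝ) := by
  obtain ⟨A, B, P, Q, R, K, hK, hP, hQ, hR, rfl, rfl⟩ := exists_cofinite_sets_missing s e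
  obtain ⟨L', hL'⟩ : ∃ L' : ℕ, (9 / 10 : ℝ) ^ L' < 1 / 60 :=
    exists_pow_lt_of_lt_one (by norm_num) (by norm_num)
  set L := 2 * K + L' with hL
  -- At least half of all sets fill the middle, as `30 * (9/10)^L' < 1/2`; overwriting the `2 * L`
  -- fringe points is at most `2 ^ (2 * L)`-to-one.
  refine ⟨1 / 2 / 2 ^ (2 * L), by positivity, ?_⟩
  filter_upwards [eventually_gt_atTop (2 * L)] with n hn
  set U := Finset.Icc 0 (n : ℤ) with hU
  set M := Finset.Icc (L : ℤ) (n - L) with hM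
  have hMU : M ⊆ U := Finset.Icc_subset_Icc (by omega) (by omega)
  set F := U.filter fun x : ℤ => (x < L ∧ x.toNat ∈ A) ∨ (n - L < x ∧ (n - x).toNat ∈ B) with hF
  have hFM : ∀ x ∈ F, x ∉ M := by
    intro x hx hxM
    simp only [hF, Finset.mem_filter] at hx
    rw [hM, Finset.mem_Icc] at hxM
    omega
  set G := U.powerset.filter fun T => FillsMiddle K (n - K) L' T with hG
  set E := U.powerset.filter fun S => missing n S = (P.card + Q.card, R.card + R.card) with hE
  have hUc : U.card = n + 1 := by simp [hU]
  have hG2 : (2 : ℝ) ^ (n + 1) / 2 ≤ G.card := by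
    have h1 := card_not_fillsMiddle_le K (n - K) L' (by omega) U
      (Finset.Icc_subset_Icc (by omega) (by omega))
    have h2 := Finset.card_filter_add_card_filter_not (s := U.powerset)
      (fun T => FillsMiddle K (n - K) L' T)
    rw [Finset.card_powerset, hUc] at h2
    rw [hUc] at h1
    have h3 : (G.card : ℝ) + ((U.powerset.filter fun T => ¬ FillsMiddle K (n - K) L' T).card : ℝ)
        = 2 ^ (n + 1) := by
      rw [← Nat.cast_add, h2]; norm_cast
    have h4 : 30 * (9 / 10 : ℝ) ^ L' * 2 ^ (n + 1) ≤ 1 / 2 * 2 ^ (n + 1) :=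
      mul_le_mul_of_nonneg_right (by linarith) (by positivity)
    linarith
  have hcard : G.card ≤ E.card * 2 ^ (2 * L) := by
    have hc : (U \ M).powerset.card = 2 ^ (2 * L) := by
      rw [Finset.card_powerset, Finset.card_sdiff_of_subset hMU, hUc, hM, Int.card_Icc]
      congr 1
      omega
    rw [← hc, ← Finset.card_product]
    refine Finset.card_le_card_of_injOn (fun T => (F ∪ T ∩ M, T \ M)) ?_ ?_
    · intro T hT
      simp only [hG, Finset.coe_filter, Set.mem_ofPred_eq, Finset.mem_powerset] at hT
      obtain ⟨hTU, hT⟩ := hT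
      simp only [Finset.coe_product, Set.mem_prod, Finset.mem_coe]
      refine ⟨Finset.mem_filter.2 ⟨?_, ?_⟩,
        Finset.mem_powerset.2 (Finset.sdiff_subset_sdiff hTU le_rfl)⟩
      · exact Finset.mem_powerset.2 (Finset.union_subset (Finset.filter_subset _ _)
          (Finset.inter_subset_left.trans hTU))
      · refine missing_eq_of_fringe hK hP hQ hR (L' := L') (by omega)
          (Finset.union_subset (Finset.filter_subset _ _) (Finset.inter_subset_left.trans hTU))
          ?_ ?_ (hT.mono ?_)
        · intro x hx
          simp only [hF, hU, hM, Finset.mem_union, Finset.mem_filter, Finset.mem_inter,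
            Finset.mem_Icc, Int.toNat_natCast]
          constructor
          · rintro (⟨_, h | h⟩ | h)
            · exact h.2
            · omega
            · omega
          · intro h
            exact Or.inl ⟨by omega, Or.inl ⟨by omega, h⟩⟩
        · intro x hx
          simp only [hF, hU, hM, Finset.mem_union, Finset.mem_filter, Finset.mem_inter,
            Finset.mem_Icc, sub_sub_cancel, Int.toNat_natCast]
          constructor
          · rintro (⟨_, h | h⟩ | h)
            · omega
            · exact h.2
            · omega
          · intro h
            exact Or.inl ⟨by omega, Or.inr ⟨by omega, h⟩⟩
        -- Overwriting the fringe loses no point of `[K, n - K]`, because `A` and `B` contain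
        -- everything from `K` on; hence the middle stays full.
        · intro x hx
          rw [Finset.mem_inter, Finset.mem_Icc] at hx
          rw [Finset.mem_union]
          by_cases hxM : x ∈ M
          · exact Or.inr (Finset.mem_inter.2 ⟨hx.1, hxM⟩)
          · refine Or.inl (Finset.mem_filter.2 ⟨hTU hx.1, ?_⟩)
            rw [hM, Finset.mem_Icc] at hxM
            rcases lt_or_ge x L with h | h
            · exact Or.inl ⟨h, (hK _ (by omega)).1⟩
            · exact Or.inr ⟨by omega, (hK _ (by omega)).2⟩
    · intro T _ T' _ h
      simp only [Prod.mk.injEq] at h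
      have hTM : ∀ T : Finset ℤ, T ∩ M = (F ∪ T ∩ M) ∩ M := by
        intro T
        ext x
        simp only [Finset.mem_inter, Finset.mem_union]
        have := hFM x
        tauto
      rw [← Finset.sdiff_union_inter T M, h.2, hTM T, h.1, ← hTM, Finset.sdiff_union_inter]
  have hcard' : (G.card : ℝ) ≤ E.card * 2 ^ (2 * L) := by exact_mod_cast hcard
  rw [div_mul_eq_mul_div, div_le_iff₀ (by positivity)]
  linarith

/-! ### Moments of the cardinality. -/

theorem sum_powerset_card_sub_half {α : Type*} [DecidableEq α] (M : Finset α) :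
    ∑ R ∈ M.powerset, ((R.card : ℝ) - M.card / 2) = 0 := by
  induction M using Finset.induction_on with
  | empty => simp
  | insert a M ha ih =>
    rw [Finset.sum_powerset_insert ha, ← Finset.sum_add_distrib, Finset.card_insert_of_notMem ha]
    rw [← mul_zero (2 : ℝ), ← ih, Finset.mul_sum]
    refine Finset.sum_congr rfl fun R hR => ?_
    rw [Finset.card_insert_of_notMem fun h => ha (Finset.mem_powerset.1 hR h)]
    push_cast
    ring

theorem sum_powerset_card_sub_half_sq {α : Type*} [DecidableEq α] (M : Finset α) :
    ∑ R ∈ M.powerset, ((R.card : ℝ) - M.card / 2) ^ 2 = (M.card : ℝ) / 4 * 2 ^ M.card := by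
  induction M using Finset.induction_on with
  | empty => simp
  | insert a M ha ih =>
    rw [Finset.sum_powerset_insert ha, ← Finset.sum_add_distrib, Finset.card_insert_of_notMem ha]
    have : ∀ R ∈ M.powerset, ((R.card : ℝ) - ((M.card + 1 : ℕ) : ℝ) / 2) ^ 2 +
        (((insert a R).card : ℝ) - ((M.card + 1 : ℕ) : ℝ) / 2) ^ 2 =
        2 * ((R.card : ℝ) - M.card / 2) ^ 2 + 1 / 2 := by
      intro R hR
      rw [Finset.card_insert_of_notMem fun h => ha (Finset.mem_powerset.1 hR h)]
      push_cast
      ring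
    rw [Finset.sum_congr rfl this, Finset.sum_add_distrib, ← Finset.mul_sum, ih,
      Finset.sum_const, Finset.card_powerset, nsmul_eq_mul]
    push_cast
    ring

/-- Independence of `S \ M` and `S ∩ M` for uniform `S`, in counting form. -/
theorem sum_powerset_sdiff_mul_inter {α : Type*} [DecidableEq α] {M U : Finset α} (hM : M ⊆ U)
    (φ ψ : Finset α → ℝ) :
    ∑ S ∈ U.powerset, φ (S \ M) * ψ (S ∩ M) =
      (∑ Q ∈ (U \ M).powerset, φ Q) * ∑ R ∈ M.powerset, ψ R := by
  rw [Finset.sum_mul_sum, ← Finset.sum_product']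
  have h1 : ∀ p ∈ (U \ M).powerset ×ˢ M.powerset, (p.1 ∪ p.2) \ M = p.1 ∧
      (p.1 ∪ p.2) ∩ M = p.2 := by
    intro p hp
    simp only [Finset.mem_product, Finset.mem_powerset] at hp
    constructor
    · ext x
      have h1 := @hp.1 x
      have h2 := @hp.2 x
      simp only [Finset.mem_sdiff, Finset.mem_union] at h1 ⊢
      tauto
    · ext x
      have h1 := @hp.1 x
      have h2 := @hp.2 x
      simp only [Finset.mem_sdiff, Finset.mem_inter, Finset.mem_union] at h1 ⊢
      tauto
  refine Finset.sum_nbij' (fun S => (S \ M, S ∩ M)) (fun p => p.1 ∪ p.2) ?_ ?_ ?_ ?_ ?_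
  · intro S hS
    simp only [Finset.mem_product, Finset.mem_powerset] at hS ⊢
    exact ⟨Finset.sdiff_subset_sdiff hS le_rfl, Finset.inter_subset_right⟩
  · intro p hp
    simp only [Finset.mem_product, Finset.mem_powerset] at hp ⊢
    exact Finset.union_subset (hp.1.trans Finset.sdiff_subset) (hp.2.trans hM)
  · intro S _
    exact Finset.sdiff_union_inter S M
  · intro p hp
    exact Prod.ext (h1 p hp).1 (h1 p hp).2
  · intro S _
    rfl

theorem abs_sum_sub_sum_le {ι : Type*} [DecidableEq ι] {V E E' B : Finset ι} (hE : E ⊆ V)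
    (hE' : E' ⊆ V) (hB : B ⊆ V) (h : ∀ S ∈ V, S ∉ B → (S ∈ E ↔ S ∈ E')) (w : ι → ℝ) (C : ℝ)
    (hw : ∀ S ∈ V, |w S| ≤ C) :
    |∑ S ∈ E, w S - ∑ S ∈ E', w S| ≤ C * B.card := by
  have hrw : ∀ X ⊆ V, ∑ S ∈ X, w S = ∑ S ∈ V, if S ∈ X then w S else 0 := by
    intro X hX
    rw [← Finset.sum_filter, Finset.filter_mem_eq_inter, Finset.inter_eq_right.2 hX]
  have hC : C * B.card = ∑ S ∈ V, if S ∈ B then C else 0 := by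
    rw [← Finset.sum_filter, Finset.filter_mem_eq_inter, Finset.inter_eq_right.2 hB,
      Finset.sum_const, nsmul_eq_mul, mul_comm]
  rw [hrw E hE, hrw E' hE', hC, ← Finset.sum_sub_distrib]
  refine (Finset.abs_sum_le_sum_abs _ _).trans (Finset.sum_le_sum fun S hS => ?_)
  have hwS := hw S hS
  have hC0 : 0 ≤ C := (abs_nonneg _).trans hwS
  by_cases hSB : S ∈ B
  · rw [if_pos hSB]
    split_ifs <;> simp [hwS, hC0]
  · rw [if_neg hSB]
    have := h S hS hSB
    by_cases hSE : S ∈ E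
    · simp [hSE, this.1 hSE]
    · simp [hSE, mt this.2 hSE]

/-- If a family `E` of subsets of `U` agrees outside `B` with a family determined by `S \ M`, then
the first two moments of `|S|` over `E` are close to those of a binomial distribution. -/
theorem moments_of_almost_determined {α : Type*} [DecidableEq α] {M U : Finset α} (hM : M ⊆ U)
    {E B : Finset (Finset α)} (hE : E ⊆ U.powerset) (hB : B ⊆ U.powerset) (p : Finset α → Prop)
    (h : ∀ S ∈ U.powerset, S ∉ B → (S ∈ E ↔ p (S \ M))) :
    |∑ S ∈ E, ((S.card : ℝ) - U.card / 2)| ≤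
      ((U \ M).card : ℝ) * E.card + (U.card : ℝ) * B.card ∧
    |∑ S ∈ E, ((S.card : ℝ) - U.card / 2) ^ 2 - (M.card : ℝ) / 4 * E.card| ≤
      ((U \ M).card : ℝ) ^ 2 * E.card + 4 * ((U.card : ℝ) ^ 2 * B.card) := by
  classical
  set u : ℝ := ((U \ M).card : ℝ) with hu
  set N : ℝ := (U.card : ℝ) with hN
  set m : ℝ := (M.card : ℝ) with hm
  have hNum : N = u + m := by
    rw [hN, hu, hm]
    exact_mod_cast (Finset.card_sdiff_add_card_eq_card hM).symm
  have hu0 : 0 ≤ u := Nat.cast_nonneg _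
  have hm0 : 0 ≤ m := Nat.cast_nonneg _
  set g : Finset α → ℝ := fun Q => Q.card - u / 2 with hg
  set k : Finset α → ℝ := fun R => R.card - m / 2 with hk
  -- The fringe part `g` is only bounded, by `u`. The centred middle part `k` has exact moments over
  -- `E'`, where it is independent of `S \ M`, so the cross term vanishes; passing from `E'` to `E`
  -- costs a multiple of `B.card`.
  have hsplit : ∀ S, (S.card : ℝ) - N / 2 = g (S \ M) + k (S ∩ M) := by
    intro S
    have : (S.card : ℝ) = (S \ M).card + (S ∩ M).card := by
      exact_mod_cast (Finset.card_sdiff_add_card_inter S M).symm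
    rw [hg, hk, this, hNum]
    ring
  have hgu : ∀ S ∈ U.powerset, |g (S \ M)| ≤ u := by
    intro S hS
    have : ((S \ M).card : ℝ) ≤ u := by
      exact Nat.cast_le.2 <| Finset.card_le_card
        (Finset.sdiff_subset_sdiff (Finset.mem_powerset.1 hS) le_rfl)
    have h0 : (0 : ℝ) ≤ (S \ M).card := Nat.cast_nonneg _
    rw [abs_le]
    constructor <;> simp only [hg] <;> linarith
  have hkm : ∀ S ∈ U.powerset, |k (S ∩ M)| ≤ m := by
    intro S hS
    have : ((S ∩ M).card : ℝ) ≤ m := by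
      exact Nat.cast_le.2 <| Finset.card_le_card Finset.inter_subset_right
    have h0 : (0 : ℝ) ≤ (S ∩ M).card := Nat.cast_nonneg _
    rw [abs_le]
    constructor <;> simp only [hk] <;> linarith
  set E' := U.powerset.filter fun S => p (S \ M) with hE'
  have h' : ∀ S ∈ U.powerset, S ∉ B → (S ∈ E ↔ S ∈ E') := by
    intro S hS hSB
    rw [hE', Finset.mem_filter, h S hS hSB]
    simp only [hS, true_and]
  have hcmp := abs_sum_sub_sum_le hE (Finset.filter_subset _ _) hB h'
  have hE'sum : ∀ φ ψ : Finset α → ℝ, ∑ S ∈ E', φ (S \ M) * ψ (S ∩ M) =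
      (∑ Q ∈ (U \ M).powerset, if p Q then φ Q else 0) * ∑ R ∈ M.powerset, ψ R := by
    intro φ ψ
    rw [← sum_powerset_sdiff_mul_inter hM, hE', Finset.sum_filter]
    refine Finset.sum_congr rfl fun S _ => ?_
    split_ifs <;> simp
  have hk1 : ∑ S ∈ E', k (S ∩ M) = 0 := by
    have := hE'sum (fun _ => 1) k
    rw [hk, sum_powerset_card_sub_half, mul_zero] at this
    simpa only [one_mul] using this
  have hgk : ∑ S ∈ E', g (S \ M) * k (S ∩ M) = 0 := by
    rw [hE'sum g k, hk, sum_powerset_card_sub_half, mul_zero]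
  have hk2 : ∑ S ∈ E', k (S ∩ M) ^ 2 = m / 4 * E'.card := by
    have h1 := hE'sum (fun _ => 1) (fun R => k R ^ 2)
    have h2 := hE'sum (fun _ => 1) (fun _ => 1)
    rw [hk, sum_powerset_card_sub_half_sq] at h1
    simp only [mul_one, one_mul, Finset.sum_const, nsmul_eq_mul, Finset.card_powerset] at h1 h2
    rw [h1, h2]
    push_cast
    ring
  have b0 := hcmp (fun _ => 1) 1 (fun S _ => by simp)
  have b1 := hcmp (fun S => k (S ∩ M)) m hkm
  have b2 := hcmp (fun S => g (S \ M) * k (S ∩ M)) (u * m) (fun S hS => by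
    rw [abs_mul]; exact mul_le_mul (hgu S hS) (hkm S hS) (abs_nonneg _) hu0)
  have b3 := hcmp (fun S => k (S ∩ M) ^ 2) (m ^ 2) (fun S hS => by
    rw [abs_pow]; exact pow_le_pow_left₀ (abs_nonneg _) (hkm S hS) 2)
  rw [hk1, sub_zero] at b1
  rw [hgk, sub_zero] at b2
  rw [hk2] at b3
  simp only [Finset.sum_const, nsmul_eq_mul, mul_one, one_mul] at b0
  have g1 : |∑ S ∈ E, g (S \ M)| ≤ u * E.card := by
    refine (Finset.abs_sum_le_sum_abs _ _).trans
      ((Finset.sum_le_sum fun S hS => hgu S (hE hS)).trans ?_)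
    rw [Finset.sum_const, nsmul_eq_mul, mul_comm]
  have g2 : |∑ S ∈ E, g (S \ M) ^ 2| ≤ u ^ 2 * E.card := by
    refine (Finset.abs_sum_le_sum_abs _ _).trans
      ((Finset.sum_le_sum (g := fun _ => u ^ 2) fun S hS => ?_).trans ?_)
    · rw [abs_pow]
      exact pow_le_pow_left₀ (abs_nonneg _) (hgu S (hE hS)) 2
    · rw [Finset.sum_const, nsmul_eq_mul, mul_comm]
  have hb0 : (0 : ℝ) ≤ B.card := Nat.cast_nonneg _
  constructor
  · rw [Finset.sum_congr rfl fun S _ => hsplit S, Finset.sum_add_distrib]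
    refine (abs_add_le _ _).trans (add_le_add g1 (b1.trans ?_))
    exact mul_le_mul_of_nonneg_right (by linarith) hb0
  · have hsq : ∑ S ∈ E, ((S.card : ℝ) - N / 2) ^ 2 = ∑ S ∈ E, g (S \ M) ^ 2 +
        2 * ∑ S ∈ E, g (S \ M) * k (S ∩ M) + ∑ S ∈ E, k (S ∩ M) ^ 2 := by
      rw [Finset.mul_sum, ← Finset.sum_add_distrib, ← Finset.sum_add_distrib]
      exact Finset.sum_congr rfl fun S _ => by rw [hsplit S]; ring
    have hm2 : m ≤ m ^ 2 := by
      rw [hm]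
      exact_mod_cast Nat.le_self_pow two_ne_zero _
    have b0' : |m / 4 * (E'.card : ℝ) - m / 4 * E.card| ≤ m ^ 2 * B.card := by
      rw [← mul_sub, abs_mul, abs_of_nonneg (by positivity : (0 : ℝ) ≤ m / 4), abs_sub_comm]
      exact mul_le_mul (by linarith) b0 (abs_nonneg _) (by positivity)
    have hfin : (2 * (u * m) + 2 * m ^ 2) * B.card ≤ 4 * (N ^ 2 * B.card) := by
      rw [← mul_assoc 4]
      refine mul_le_mul_of_nonneg_right ?_ hb0
      rw [hNum]
      nlinarith [mul_nonneg hu0 hm0, sq_nonneg u, sq_nonneg m]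
    rw [hsq, abs_le]
    rw [abs_le] at g2 b2 b3 b0'
    constructor <;> linarith [g2.1, g2.2, b2.1, b2.2, b3.1, b3.2, b0'.1, b0'.2]

/-- Any sum or difference using a point of `[L, n - L]` lies in the range that `S` already covers,
so adding such points creates nothing new. As `S ∪ M = (S \ M) ∪ M`, the pair depends only on `S \
M`. -/
theorem missing_union_Icc {n L : ℕ} {S : Finset ℤ} (hS : S ⊆ Finset.Icc 0 (n : ℤ))
    (hfill : FillsMiddle 0 n L S) :
    missing n (S ∪ Finset.Icc (L : ℤ) (n - L)) = missing n S := by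
  have hb : ∀ x ∈ S ∪ Finset.Icc (L : ℤ) (n - L),
      0 ≤ x ∧ x ≤ n ∧ (x ∈ S ∨ L ≤ x ∧ x ≤ n - L) := by
    intro x hx
    rcases Finset.mem_union.1 hx with h | h
    · have := Finset.mem_Icc.1 (hS h)
      exact ⟨this.1, this.2, Or.inl h⟩
    · have := Finset.mem_Icc.1 h
      exact ⟨by omega, by omega, Or.inr this⟩
  have h1 := hfill.1.trans
    (Finset.add_subset_add Finset.inter_subset_left Finset.inter_subset_left)
  have h2 := hfill.2.trans
    (Finset.sub_subset_sub Finset.inter_subset_left Finset.inter_subset_left)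
  have hadd : (S ∪ Finset.Icc (L : ℤ) (n - L)) + (S ∪ Finset.Icc (L : ℤ) (n - L)) = S + S := by
    refine le_antisymm (fun k hk => ?_)
      (Finset.add_subset_add Finset.subset_union_left Finset.subset_union_left)
    obtain ⟨x, hx, y, hy, rfl⟩ := Finset.mem_add.1 hk
    obtain ⟨hx0, hxn, hx⟩ := hb x hx
    obtain ⟨hy0, hyn, hy⟩ := hb y hy
    rcases hx with hx | hx
    · rcases hy with hy | hy
      · exact Finset.add_mem_add hx hy
      · exact h1 (Finset.mem_Icc.2 ⟨by omega, by omega⟩)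
    · exact h1 (Finset.mem_Icc.2 ⟨by omega, by omega⟩)
  have hsub : (S ∪ Finset.Icc (L : ℤ) (n - L)) - (S ∪ Finset.Icc (L : ℤ) (n - L)) = S - S := by
    refine le_antisymm (fun k hk => ?_)
      (Finset.sub_subset_sub Finset.subset_union_left Finset.subset_union_left)
    obtain ⟨x, hx, y, hy, rfl⟩ := Finset.mem_sub.1 hk
    obtain ⟨hx0, hxn, hx⟩ := hb x hx
    obtain ⟨hy0, hyn, hy⟩ := hb y hy
    rcases hx with hx | hx
    · rcases hy with hy | hy
      · exact Finset.sub_mem_sub hx hy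
      · exact h2 (Finset.mem_Icc.2 ⟨by omega, by omega⟩)
    · exact h2 (Finset.mem_Icc.2 ⟨by omega, by omega⟩)
  rw [missing, missing, hadd, hsub]

/-! ### Conditional expectation and variance, and the choice of `L`. -/

theorem integral_uniformOn_finset {Ω : Type*} [MeasurableSpace Ω] [MeasurableSingletonClass Ω]
    (E : Finset Ω) (f : Ω → ℝ) :
    ∫ x, f x ∂(uniformOn (E : Set Ω)) = (∑ x ∈ E, f x) / E.card := by
  have hint : IntegrableOn f (E : Set Ω) Measure.count := by
    have h : IntegrableOn f (⋃ x ∈ E, {x}) Measure.count :=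
      integrableOn_finset_iUnion.2 fun x _ =>
        integrableOn_singleton (hx := by rw [Measure.count_singleton]; exact ENNReal.one_lt_top)
    convert h using 1
    ext x
    simp
  rw [uniformOn, ProbabilityTheory.cond, integral_smul_measure, setIntegral_finset E hint, Measure.count_apply_finset]
  simp [measureReal_def, div_eq_inv_mul]

theorem variance_uniformOn_finset {Ω : Type*} [MeasurableSpace Ω] [DiscreteMeasurableSpace Ω]
    {E : Finset Ω} (hE : E.Nonempty) (f : Ω → ℝ) (c : ℝ) :
    variance f (uniformOn (E : Set Ω)) =
      (∑ x ∈ E, (f x - c) ^ 2) / E.card - ((∑ x ∈ E, (f x - c)) / E.card) ^ 2 := by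
  have hE0 : (E.card : ℝ) ≠ 0 := by exact_mod_cast hE.card_pos.ne'
  rw [variance_eq_integral (Measurable.of_discrete).aemeasurable, integral_uniformOn_finset,
    integral_uniformOn_finset]
  have hmean : (∑ x ∈ E, f x) / E.card = (∑ x ∈ E, (f x - c)) / E.card + c := by
    rw [Finset.sum_sub_distrib, Finset.sum_const, nsmul_eq_mul]
    field_simp
    ring
  rw [hmean]
  set a := (∑ x ∈ E, (f x - c)) / E.card with ha
  have ha' : ∑ x ∈ E, (f x - c) = a * E.card := by rw [ha]; field_simp
  have : ∑ x ∈ E, (f x - (a + c)) ^ 2 = ∑ x ∈ E, (f x - c) ^ 2 - a ^ 2 * E.card := by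
    have h1 : ∀ x ∈ E, (f x - (a + c)) ^ 2 = (f x - c) ^ 2 - 2 * a * (f x - c) + a ^ 2 :=
      fun x _ => by ring
    rw [Finset.sum_congr rfl h1, Finset.sum_add_distrib, Finset.sum_sub_distrib, ← Finset.mul_sum,
      ha', Finset.sum_const, nsmul_eq_mul]
    ring
  rw [this]
  field_simp

theorem finite_setOf_subset_finset {α : Type*} (U : Finset α) : {S : Finset α | S ⊆ U}.Finite :=
  U.powerset.finite_toSet.subset fun _ hS => Finset.mem_coe.2 (Finset.mem_powerset.2 hS)

open Classical in
theorem conditionedSubset_eq_uniformOn (Λ : Set (ℕ × ℕ)) (n : ℕ) :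
    conditionedSubset Λ n = uniformOn (((Finset.Icc 0 (n : ℤ)).powerset.filter
      fun S => missing n S ∈ Λ : Finset (Finset ℤ)) : Set (Finset ℤ)) := by
  have hfin : {S : Finset ℤ | S ⊆ Finset.Icc 0 (n : ℤ)}.Finite :=
      finite_setOf_subset_finset _
  rw [conditionedSubset, randomSubset, uniformOn, uniformOn,
    cond_cond_eq_cond_inter' MeasurableSet.of_discrete MeasurableSet.of_discrete
      (Measure.count_apply_lt_top.2 hfin).ne]
  congr 1
  ext S
  simp only [missingEvent, Set.mem_inter_iff, Set.mem_ofPred_eq, Finset.mem_coe,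
    Finset.mem_filter, Finset.mem_powerset]

open Classical in
theorem moments_conditionedSubset (Λ : Set (ℕ × ℕ)) {n L : ℕ} (hn : 2 * L < n) {c : ℝ} (hc : 0 < c)
    (hE : c * 2 ^ (n + 1) ≤ (((Finset.Icc 0 (n : ℤ)).powerset.filter
      fun S => missing n S ∈ Λ).card : ℝ)) (hL : (9 / 10 : ℝ) ^ L ≤ ((n : ℝ) ^ 2)⁻¹) :
    |(∫ S, (S.card : ℝ) ∂(conditionedSubset Λ n)) - ((n : ℝ) + 1) / 2| ≤ 2 * L + 120 / c ∧
    |variance (fun S : Finset ℤ => (S.card : ℝ)) (conditionedSubset Λ n) - ((n : ℝ) + 1) / 4| ≤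
      (2 * L) ^ 2 + 480 / c + 2 * L + (2 * L + 120 / c) ^ 2 := by
  set U := Finset.Icc 0 (n : ℤ) with hU
  set M := Finset.Icc (L : ℤ) (n - L) with hM
  set E := U.powerset.filter fun S => missing n S ∈ Λ with hEdef
  set B := U.powerset.filter fun T => ¬ FillsMiddle 0 n L T with hB
  have hMU : M ⊆ U := Finset.Icc_subset_Icc (by omega) (by omega)
  have hUc : U.card = n + 1 := by simp [hU]
  have hMc : M.card + 2 * L = n + 1 := by
    rw [hM, Int.card_Icc]
    omega
  have hUMc : (U \ M).card = 2 * L := by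
    have := Finset.card_sdiff_add_card_eq_card hMU
    omega
  have hEpos : (0 : ℝ) < E.card := lt_of_lt_of_le (by positivity) hE
  have hEne : E.Nonempty := by
    rw [← Finset.card_pos]
    exact_mod_cast hEpos
  have hn1 : (1 : ℝ) ≤ n := by exact_mod_cast (by omega : 1 ≤ n)
  -- The bad sets are a fraction `30 / n²` of all sets and `E` at least a fraction `c`, so even
  -- weighted by the square of the size the bad sets are negligible; `120 = 4 * 30` comes from `(n +
  -- 1)² ≤ 4n²`.
  have hBc : ((n : ℝ) + 1) ^ 2 * B.card ≤ 120 / c * E.card := by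
    have h1 := card_not_fillsMiddle_le 0 n L (by omega) U le_rfl
    rw [hUc] at h1
    have h2 : ((n : ℝ) + 1) ^ 2 ≤ 4 * n ^ 2 := by nlinarith
    calc ((n : ℝ) + 1) ^ 2 * B.card
        ≤ (4 * n ^ 2) * (30 * ((n : ℝ) ^ 2)⁻¹ * 2 ^ (n + 1)) := by
          refine mul_le_mul h2 (h1.trans ?_) (Nat.cast_nonneg _) (by positivity)
          gcongr
      _ = 120 / c * (c * 2 ^ (n + 1)) := by
          field_simp
          ring
      _ ≤ _ := mul_le_mul_of_nonneg_left hE (by positivity)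
  obtain ⟨h1, h2⟩ := moments_of_almost_determined hMU (E := E) (B := B) (Finset.filter_subset _ _)
    (Finset.filter_subset _ _) (fun Q => missing n (Q ∪ M) ∈ Λ) (by
      intro S hS hSB
      have hfill : FillsMiddle 0 n L S := by
        by_contra h
        exact hSB (Finset.mem_filter.2 ⟨hS, h⟩)
      rw [Finset.sdiff_union_self_eq_union, hM,
        missing_union_Icc (Finset.mem_powerset.1 hS) hfill, hEdef, Finset.mem_filter]
      simp only [hS, true_and])
  have hMc' : (M.card : ℝ) = n + 1 - 2 * L := by
    rw [eq_sub_iff_add_eq]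
    exact_mod_cast hMc
  rw [hUMc, hUc] at h1 h2
  rw [hMc'] at h2
  push_cast at h1 h2
  have h3 : ((n : ℝ) + 1) * B.card ≤ 120 / c * E.card :=
    le_trans (mul_le_mul_of_nonneg_right (by nlinarith) (Nat.cast_nonneg _)) hBc
  have hmean : |(∑ S ∈ E, ((S.card : ℝ) - ((n : ℝ) + 1) / 2)) / E.card| ≤ 2 * L + 120 / c := by
    rw [abs_div, abs_of_pos hEpos, div_le_iff₀ hEpos]
    linarith
  have hsq : |(∑ S ∈ E, ((S.card : ℝ) - ((n : ℝ) + 1) / 2) ^ 2) / E.card - ((n : ℝ) + 1 - 2 * L) / 4| ≤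
      (2 * L) ^ 2 + 480 / c := by
    rw [← mul_div_cancel_right₀ (((n : ℝ) + 1 - 2 * L) / 4) hEpos.ne', ← sub_div, abs_div,
      abs_of_pos hEpos, div_le_iff₀ hEpos]
    have : 480 / c * (E.card : ℝ) = 4 * (120 / c * E.card) := by ring
    linarith
  rw [conditionedSubset_eq_uniformOn, ← hU, ← hEdef]
  constructor
  · rw [integral_uniformOn_finset]
    convert hmean using 2
    rw [Finset.sum_sub_distrib, Finset.sum_const, nsmul_eq_mul]
    field_simp
  · rw [variance_uniformOn_finset hEne _ (((n : ℝ) + 1) / 2)]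
    have h4 := pow_le_pow_left₀ (abs_nonneg _) hmean 2
    rw [sq_abs] at h4
    have h5 := sq_nonneg ((∑ S ∈ E, ((S.card : ℝ) - ((n : ℝ) + 1) / 2)) / E.card)
    have hL0 : (0 : ℝ) ≤ L := Nat.cast_nonneg _
    rw [abs_le] at hsq ⊢
    constructor <;> linarith [hsq.1, hsq.2]

theorem pow_ceil_log_le {n : ℕ} (hn : 1 ≤ n) :
    (9 / 10 : ℝ) ^ ⌈20 * Real.log n⌉₊ ≤ ((n : ℝ) ^ 2)⁻¹ := by
  have hn' : (0 : ℝ) < n := by exact_mod_cast hn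
  have h1 : (9 / 10 : ℝ) ≤ Real.exp (-(1 / 10)) := by
    have := Real.one_sub_le_exp_neg (1 / 10)
    linarith
  calc (9 / 10 : ℝ) ^ ⌈20 * Real.log n⌉₊
      ≤ Real.exp (-(1 / 10)) ^ ⌈20 * Real.log n⌉₊ := pow_le_pow_left₀ (by norm_num) h1 _
    _ = Real.exp (⌈20 * Real.log n⌉₊ * -(1 / 10)) := (Real.exp_nat_mul _ _).symm
    _ ≤ Real.exp (-(2 * Real.log n)) := by
        have := Nat.le_ceil (20 * Real.log n)
        exact Real.exp_le_exp.2 (by linarith)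
    _ = _ := by
        rw [Real.exp_neg, two_mul, Real.exp_add, Real.exp_log hn', sq]

theorem mainTheorem7 (Λ : Set (ℕ × ℕ)) (hΛ : ∃ s d : ℕ, (s, d) ∈ Λ ∧ Even d) :
    (∀ᶠ n : ℕ in atTop, randomSubset n (missingEvent Λ n) ≠ 0) ∧
    (fun n : ℕ => (∫ S, (S.card : ℝ) ∂(conditionedSubset Λ n)) - ((n : ℝ) + 1) / 2)
      =O[atTop] (fun n : ℕ => Real.log n) ∧
    (fun n : ℕ => variance (fun S : Finset ℤ => (S.card : ℝ)) (conditionedSubset Λ n)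
        - ((n : ℝ) + 1) / 4)
      =O[atTop] (fun n : ℕ => Real.log n ^ 2) := by
  classical
  obtain ⟨s, _, hsd, e, rfl⟩ := hΛ
  obtain ⟨c, hc, hpos⟩ := exists_pos_le_card_missing s e
  have hE : ∀ᶠ n : ℕ in atTop, c * 2 ^ (n + 1) ≤ (((Finset.Icc 0 (n : ℤ)).powerset.filter
      fun S => missing n S ∈ Λ).card : ℝ) := by
    filter_upwards [hpos] with n hn
    refine hn.trans (Nat.cast_le.2 (Finset.card_le_card ?_))
    exact Finset.monotone_filter_right _ fun S _ hS => hS ▸ hsd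
  have hlog : ∀ᶠ n : ℕ in atTop, 1 ≤ Real.log n :=
    (Real.tendsto_log_atTop.comp tendsto_natCast_atTop_atTop).eventually_ge_atTop 1
  -- With `L = ⌈20 log n⌉ ≤ 21 log n`, this gives the strict inequality `2 * L < n`.
  have hlog' : ∀ᶠ n : ℕ in atTop, 44 * Real.log n ≤ n := by
    have := (Real.isLittleO_log_id_atTop.comp_tendsto
      (tendsto_natCast_atTop_atTop (R := ℝ))).bound (c := 1 / 44) (by norm_num)
    filter_upwards [this] with n hn
    simp only [Function.comp_apply, id, Real.norm_eq_abs, Nat.abs_cast] at hn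
    linarith [le_abs_self (Real.log n)]
  have hmom : ∀ᶠ n : ℕ in atTop,
      |(∫ S, (S.card : ℝ) ∂(conditionedSubset Λ n)) - ((n : ℝ) + 1) / 2| ≤
        (42 + 120 / c) * Real.log n ∧
      |variance (fun S : Finset ℤ => (S.card : ℝ)) (conditionedSubset Λ n) - ((n : ℝ) + 1) / 4| ≤
        (42 ^ 2 + 480 / c + 42 + (42 + 120 / c) ^ 2) * Real.log n ^ 2 := by
    filter_upwards [hE, hlog, hlog', eventually_ge_atTop 1] with n hn h1 h2 hn1
    set l := Real.log n with hl
    have hceil : (⌈20 * l⌉₊ : ℝ) ≤ 21 * l := by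
      have := Nat.ceil_lt_add_one (a := 20 * l) (by linarith)
      linarith
    set L := ⌈20 * l⌉₊ with hL
    have hLn : 2 * L < n := by
      have : (2 * L : ℝ) < n := by linarith
      exact_mod_cast this
    obtain ⟨m1, m2⟩ := moments_conditionedSubset Λ hLn hc hn (pow_ceil_log_le hn1)
    have hL0 : (0 : ℝ) ≤ L := Nat.cast_nonneg _
    have hc0 : 0 < 120 / c := by positivity
    have hc1 : 0 < 480 / c := by positivity
    have hl2 : l ≤ l ^ 2 := by nlinarith
    have a1 : 2 * (L : ℝ) + 120 / c ≤ (42 + 120 / c) * l := by nlinarith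
    refine ⟨m1.trans a1, m2.trans ?_⟩
    have a2 := pow_le_pow_left₀ (by positivity) a1 2
    have a3 := pow_le_pow_left₀ (by positivity) (by linarith : 2 * (L : ℝ) ≤ 42 * l) 2
    have a4 : 480 / c ≤ 480 / c * l ^ 2 := le_mul_of_one_le_right hc1.le (by linarith)
    rw [mul_pow] at a2
    linarith
  refine ⟨?_, ?_, ?_⟩
  · filter_upwards [hE] with n hn h0
    have hfin : {S : Finset ℤ | S ⊆ Finset.Icc 0 (n : ℤ)}.Finite :=
      finite_setOf_subset_finset _
    rw [randomSubset, uniformOn_eq_zero_iff hfin] at h0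
    have hcard : (0 : ℝ) < (((Finset.Icc 0 (n : ℤ)).powerset.filter
      fun S => missing n S ∈ Λ).card : ℝ) := lt_of_lt_of_le (by positivity) hn
    obtain ⟨S, hS⟩ := Finset.card_pos.1 (Nat.cast_pos.1 hcard)
    rw [Finset.mem_filter, Finset.mem_powerset] at hS
    exact Set.eq_empty_iff_forall_notMem.1 h0 S ⟨hS.1, hS.2⟩
  · refine IsBigO.of_bound (42 + 120 / c) ?_
    filter_upwards [hmom, hlog] with n hn h1
    rw [Real.norm_eq_abs, Real.norm_eq_abs, abs_of_nonneg (by linarith : 0 ≤ Real.log n)]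
    exact hn.1
  · refine IsBigO.of_bound (42 ^ 2 + 480 / c + 42 + (42 + 120 / c) ^ 2) ?_
    filter_upwards [hmom] with n hn
    rw [Real.norm_eq_abs, Real.norm_eq_abs, abs_of_nonneg (sq_nonneg (Real.log n))]
    exact hn.2
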